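/- Call a Borel probability measure $\mu$ on $[0,1]$ admissible if it is non-atomic and $0,1\in\operatorname{supp}\mu$. For such $\mu$, let $\mathcal D_\mu^2$ be the set of all $f\in C^1([0,1])$ for which there is $(f')^\mu\in L^2([0,1],\mu)$ with $f'(x)=f'(0)+\int_0^x (f')^\mu\,d\mu$ for all $x\in[0,1]$. For $b\in\{N,D\}$ let $\Delta_\mu^b$ be the Krein–Feller operator on $L^2([0,1],\mu)$ whose domain consists of the classes with a representative $\bar f\in\mathcal D_\mu^2$ satisfying $\bar f'(0)=\bar f'(1)=0$ if $b=N$ and $\bar f(0)=\bar f(1)=0$ if $b=D$, with $\Delta_\mu^b f=(\bar f')^\mu$; for $\lambda>0$ let $R_\lambda^b=(\lambda-\Delta_\mu^b)^{-1}$. Let $(C[0,1])_\mu^N$ be the space of all classes in $L^2([0,1],\mu)$ that possess a continuous representative on $[0,1]$, and $(C[0,1])_\mu^D$ the space of those that possess a continuous representative vanishing at $0$ and $1$; both carry the norm $\|f\|_\infty=\sup_{x\in\operatorname{supp}\mu}|f(x)|$, where $f(x)$ is evaluated with a continuous representative. Let $\mu$ and $\mu_n$ $(n\in\mathbb N)$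 be admissible measures such that $\mu_n\rightharpoonup\mu$ weakly and $\operatorname{supp}\mu\subseteq\operatorname{supp}\mu_n$ for all $n$. Let $\pi_n:(C[0,1])_\mu^b\to(C[0,1])_{\mu_n}^b$ send $f$ to the $L^2([0,1],\mu_n)$-class of the continuous representative of $f$ that is linear on every interval of $[0,1]\setminus\operatorname{supp}\mu$, and let $R_{\lambda,n}^b=(\lambda-\Delta_{\mu_n}^b)^{-1}$. Then, for $b\in\{N,D\}$ and every $\lambda>0$, the operators $\lambda-\Delta_\mu^b$ and $\lambda-\Delta_{\mu_n}^b$ are bijections of their domains onto $L^2([0,1],\mu)$ and $L^2([0,1],\mu_n)$, respectively (so the resolvents are well defined), and for every $f\in(C[0,1])_\mu^b$ $$\lim_{n\to\infty}\bigl\|R_{\lambda,n}^b\,\pi_n f-\pi_n R_\lambda^b f\bigr\|_\infty=0 .$$ -/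

import Mathlib

open MeasureTheory Set Filter Topology

namespace KreinFeller

/-- The measures under consideration: non-atomic Borel probability measures on `[0,1]`
(viewed as Borel measures on `ℝ` carried by `[0,1]`) whose support contains `0` and `1`. -/
class Admissible (μ : Measure ℝ) : Prop extends IsProbabilityMeasure μ, NullSingletonClass μ where
  null_compl : μ (Icc 0 1)ᶜ = 0
  zero_mem : (0 : ℝ) ∈ μ.support
  one_mem : (1 : ℝ) ∈ μ.support

/-- The two boundary conditions. -/
inductive BC
  | neumann
  | dirichlet

/-! ### Facts on admissible measures used by the definitions -/

section Aux

variable {μ : Measure ℝ} [Admissible μ]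

theorem support_subset : μ.support ⊆ Icc 0 1 :=
  Measure.support_subset_of_isClosed isClosed_Icc
    (mem_ae_iff.2 (Admissible.null_compl (μ := μ)))

theorem restrict_Icc : μ.restrict (Icc 0 1) = μ :=
  Measure.restrict_eq_self_of_ae_mem (mem_ae_iff.2 (Admissible.null_compl (μ := μ)))

theorem memLp_of_continuousOn {g : ℝ → ℝ} (hg : ContinuousOn g (Icc 0 1)) : MemLp g 2 μ := by
  obtain ⟨C, hC⟩ := isCompact_Icc.exists_bound_of_continuousOn hg
  have h1 : AEStronglyMeasurable g μ := by
    have := hg.aestronglyMeasurable (μ := μ) measurableSet_Icc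
    rwa [restrict_Icc] at this
  refine MemLp.of_bound h1 C ?_
  have : ∀ᵐ x ∂μ, x ∈ Icc (0 : ℝ) 1 := mem_ae_iff.2 (Admissible.null_compl (μ := μ))
  filter_upwards [this] with x hx using hC x hx

theorem exists_mem_support_ne {x : ℝ} (hx : x ∈ μ.support) {U : Set ℝ} (hU : U ∈ 𝓝 x) :
    ∃ y ∈ U, y ≠ x ∧ y ∈ μ.support := by
  have h0 : 0 < μ (U \ {x}) := by
    rw [measure_sdiff_null (measure_singleton x)]
    exact (Measure.mem_support_iff_forall x).1 hx U hU
  obtain ⟨y, hy, hy'⟩ := Measure.nonempty_inter_support_of_pos h0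
  exact ⟨y, hy.1, hy.2, hy'⟩

theorem eq_zero_on_support {f : ℝ → ℝ} (hf : ContinuousOn f (Icc 0 1)) (h0 : f =ᵐ[μ] 0)
    {x : ℝ} (hx : x ∈ μ.support) : f x = 0 := by
  by_contra hne
  have h1 : {y | f y ≠ 0} ∈ 𝓝[Icc 0 1] x :=
    (hf x (support_subset hx)) (isOpen_ne.mem_nhds hne)
  obtain ⟨U, hU, hUs⟩ := mem_nhdsWithin_iff_exists_mem_nhds_inter.1 h1
  have h2 := (Measure.mem_support_iff_forall x).1 hx U hU
  have h3 : μ U ≤ μ ((Icc 0 1)ᶜ ∪ {y | f y ≠ 0}) := by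
    refine measure_mono fun y hy => ?_
    by_cases hyI : y ∈ Icc (0 : ℝ) 1
    · exact Or.inr (hUs ⟨hy, hyI⟩)
    · exact Or.inl hyI
  have h4 : μ ((Icc 0 1)ᶜ ∪ {y | f y ≠ 0}) = 0 :=
    measure_union_null (Admissible.null_compl) (ae_iff.1 h0)
  exact absurd (h3.trans h4.le) (not_le.2 h2)

end Aux

/-! ### The spaces of continuous functions -/

/-- The admissible boundary values of a continuous representative: none for Neumann, `g 0 = g 1 = 0`
for Dirichlet boundary conditions. -/
def BC.Vanish : BC → (ℝ → ℝ) → Prop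
  | .neumann, _ => True
  | .dirichlet, g => g 0 = 0 ∧ g 1 = 0

/-- The space `(C[0,1])_μ^b` of all `L²(μ)`-classes possessing a continuous representative on
`[0,1]` (with zero boundary values in the Dirichlet case). -/
def CSpace (μ : Measure ℝ) (b : BC) : Submodule ℝ (Lp ℝ 2 μ) where
  carrier := {f | ∃ g : ℝ → ℝ, ContinuousOn g (Icc 0 1) ∧ b.Vanish g ∧ f =ᵐ[μ] g}
  zero_mem' := ⟨fun _ => 0, continuousOn_const, by cases b <;> simp [BC.Vanish],
    Lp.coeFn_zero ℝ 2 μ⟩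
  add_mem' := by
    rintro f₁ f₂ ⟨g₁, hc₁, hb₁, h₁⟩ ⟨g₂, hc₂, hb₂, h₂⟩
    refine ⟨g₁ + g₂, hc₁.add hc₂, ?_, (Lp.coeFn_add f₁ f₂).trans (h₁.add h₂)⟩
    cases b <;> simp_all [BC.Vanish]
  smul_mem' := by
    rintro c f ⟨g, hc, hb, h⟩
    refine ⟨c • g, hc.const_smul c, ?_, (Lp.coeFn_smul c f).trans (h.const_smul c)⟩
    cases b <;> simp_all [BC.Vanish]

/-- `gapLinear K g` agrees with `g` on the closed set `K` and interpolates `g` linearly on every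
gap of `K`: if `l` is the last point of `K` before `x` and `r` the first one after `x`, its value
at `x` is `g l + (x - l) / (r - l) * (g r - g l)` (which is `g x` when `x ∈ K`, as then
`l = r = x`). -/
noncomputable def gapLinear (K : Set ℝ) (g : ℝ → ℝ) (x : ℝ) : ℝ :=
  g (sSup (K ∩ Iic x)) + (x - sSup (K ∩ Iic x)) / (sInf (K ∩ Ici x) - sSup (K ∩ Iic x)) *
    (g (sInf (K ∩ Ici x)) - g (sSup (K ∩ Iic x)))

theorem gapLinear_of_mem {K : Set ℝ} {g : ℝ → ℝ} {x : ℝ} (hx : x ∈ K) :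
    gapLinear K g x = g x := by
  have h1 : IsGreatest (K ∩ Iic x) x := ⟨⟨hx, le_refl x⟩, fun y hy => hy.2⟩
  simp [gapLinear, h1.csSup_eq]

theorem gapLinear_of_gap {K : Set ℝ} {g : ℝ → ℝ} {l r x : ℝ} (hl : l ∈ K) (hr : r ∈ K)
    (hgap : ∀ y ∈ K, y ≤ l ∨ r ≤ y) (hx : x ∈ Icc l r) :
    gapLinear K g x = g l + (x - l) / (r - l) * (g r - g l) := by
  rcases eq_or_lt_of_le hx.1 with rfl | hlx
  · simp [gapLinear_of_mem hl]
  rcases eq_or_lt_of_le hx.2 with rfl | hxr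
  · rw [gapLinear_of_mem hr, div_self (sub_ne_zero.2 hlx.ne')]; ring
  have h1 : IsGreatest (K ∩ Iic x) l := ⟨⟨hl, hlx.le⟩, fun y hy =>
    (hgap y hy.1).resolve_right (not_le.2 (lt_of_le_of_lt hy.2 hxr))⟩
  have h2 : IsLeast (K ∩ Ici x) r := ⟨⟨hr, hxr.le⟩, fun y hy =>
    (hgap y hy.1).resolve_left (not_le.2 (lt_of_lt_of_le hlx hy.2))⟩
  simp [gapLinear, h1.csSup_eq, h2.csInf_eq]

theorem exists_gap {K : Set ℝ} (hK : IsClosed K) {p q x : ℝ} (hp : p ∈ K) (hq : q ∈ K)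
    (hx : x ∈ Icc p q) : ∃ l ∈ K, ∃ r ∈ K, (∀ y ∈ K, y ≤ l ∨ r ≤ y) ∧
      x ∈ Icc l r ∧ p ≤ l ∧ r ≤ q := by
  have hb1 : BddAbove (K ∩ Iic x) := ⟨x, fun y hy => hy.2⟩
  have hb2 : BddBelow (K ∩ Ici x) := ⟨x, fun y hy => hy.2⟩
  have h1 := (hK.inter isClosed_Iic).csSup_mem ⟨p, hp, hx.1⟩ hb1
  have h2 := (hK.inter isClosed_Ici).csInf_mem ⟨q, hq, hx.2⟩ hb2
  refine ⟨_, h1.1, _, h2.1, fun y hy => ?_, ⟨h1.2, h2.2⟩,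
    le_csSup hb1 ⟨hp, hx.1⟩, csInf_le hb2 ⟨hq, hx.2⟩⟩
  rcases le_total y x with h | h
  · exact Or.inl (le_csSup hb1 ⟨hy, h⟩)
  · exact Or.inr (csInf_le hb2 ⟨hy, h⟩)

theorem continuousOn_gapLinear_gap {K : Set ℝ} {g : ℝ → ℝ} {l r : ℝ} (hl : l ∈ K) (hr : r ∈ K)
    (hgap : ∀ y ∈ K, y ≤ l ∨ r ≤ y) : ContinuousOn (gapLinear K g) (Icc l r) := by
  have : ContinuousOn (fun x : ℝ => g l + (x - l) / (r - l) * (g r - g l)) (Icc l r) := by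
    fun_prop
  exact this.congr fun x hx => gapLinear_of_gap hl hr hgap hx

theorem abs_gapLinear_sub_lt {K : Set ℝ} (hK : IsClosed K) {g : ℝ → ℝ} {p q x c ε : ℝ}
    (hp : p ∈ K) (hq : q ∈ K) (hx : x ∈ Icc p q) (hg : ∀ y ∈ K ∩ Icc p q, |g y - c| < ε) :
    |gapLinear K g x - c| < ε := by
  obtain ⟨l, hl, r, hr, hgap, hxlr, hpl, hrq⟩ := exists_gap hK hp hq hx
  rw [gapLinear_of_gap hl hr hgap hxlr]
  have h1 := hg l ⟨hl, hpl, (hxlr.1.trans hxlr.2).trans hrq⟩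
  have h2 := hg r ⟨hr, hpl.trans (hxlr.1.trans hxlr.2), hrq⟩
  set t := (x - l) / (r - l) with ht
  have ht0 : 0 ≤ t := div_nonneg (by linarith [hxlr.1]) (by linarith [hxlr.1, hxlr.2])
  have ht1 : t ≤ 1 := div_le_one_of_le₀ (by linarith [hxlr.2]) (by linarith [hxlr.1, hxlr.2])
  refine lt_of_le_of_lt ?_ (max_lt h1 h2)
  have k1 := abs_le.1 (le_max_left |g l - c| |g r - c|)
  have k2 := abs_le.1 (le_max_right |g l - c| |g r - c|)
  set M := max |g l - c| |g r - c|
  rw [abs_le]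
  constructor <;> nlinarith [mul_nonneg ht0 (sub_nonneg.2 k2.1), mul_nonneg ht0 (sub_nonneg.2 k2.2),
    mul_nonneg (sub_nonneg.2 ht1) (sub_nonneg.2 k1.1),
    mul_nonneg (sub_nonneg.2 ht1) (sub_nonneg.2 k1.2)]

theorem continuousOn_gapLinear {K : Set ℝ} (hK : IsClosed K) {g : ℝ → ℝ} {p q : ℝ}
    (hp : p ∈ K) (hq : q ∈ K) (hg : ContinuousOn g K) :
    ContinuousOn (gapLinear K g) (Icc p q) := by
  intro x₀ hx₀
  by_cases hxK : x₀ ∈ K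
  · have hleft : ContinuousWithinAt (gapLinear K g) (Icc p x₀) x₀ := by
      rcases eq_or_lt_of_le hx₀.1 with rfl | hlt
      · simp
      by_cases hacc : ∀ δ > 0, ∃ y ∈ K, x₀ - δ < y ∧ y < x₀
      · rw [Metric.continuousWithinAt_iff]
        intro ε hε
        obtain ⟨δ, hδ, H⟩ := Metric.continuousWithinAt_iff.1 (hg x₀ hxK) ε hε
        obtain ⟨y, hy, hy1, hy2⟩ := hacc δ hδ
        refine ⟨x₀ - y, by linarith, fun {x} hx hxd => ?_⟩
        rw [Real.dist_eq] at hxd ⊢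
        rw [gapLinear_of_mem hxK]
        refine abs_gapLinear_sub_lt hK hy hxK ⟨by linarith [(abs_lt.1 hxd).1], hx.2⟩ ?_
        rintro z ⟨hz, hz1, hz2⟩
        have := H hz (by rw [Real.dist_eq, abs_lt]; constructor <;> linarith)
        rwa [Real.dist_eq] at this
      · push Not at hacc
        obtain ⟨δ, hδ, H⟩ := hacc
        have hm0 : 0 < min δ (x₀ - p) := lt_min hδ (by linarith)
        have hm1 := min_le_left δ (x₀ - p)
        have hm2 := min_le_right δ (x₀ - p)
        set m := min δ (x₀ - p)
        obtain ⟨l, hl, r, hr, hgap, hxlr, hpl, hrq⟩ := exists_gap hK hp hxK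
          (x := x₀ - m / 2) ⟨by linarith, by linarith⟩
        have hrx : r = x₀ := le_antisymm hrq (H r hr (by linarith [hxlr.2]))
        subst hrx
        have hc := continuousOn_gapLinear_gap (g := g) hl hr hgap r ⟨by linarith [hxlr.1], le_rfl⟩
        refine hc.mono_of_mem_nhdsWithin ?_
        refine mem_nhdsWithin.2 ⟨Ioi l, isOpen_Ioi, mem_Ioi.2 (by linarith [hxlr.1]), ?_⟩
        exact fun y hy => ⟨le_of_lt hy.1, hy.2.2⟩
    have hright : ContinuousWithinAt (gapLinear K g) (Icc x₀ q) x₀ := by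
      rcases eq_or_lt_of_le hx₀.2 with rfl | hlt
      · simp
      by_cases hacc : ∀ δ > 0, ∃ y ∈ K, x₀ < y ∧ y < x₀ + δ
      · rw [Metric.continuousWithinAt_iff]
        intro ε hε
        obtain ⟨δ, hδ, H⟩ := Metric.continuousWithinAt_iff.1 (hg x₀ hxK) ε hε
        obtain ⟨y, hy, hy1, hy2⟩ := hacc δ hδ
        refine ⟨y - x₀, by linarith, fun {x} hx hxd => ?_⟩
        rw [Real.dist_eq] at hxd ⊢
        rw [gapLinear_of_mem hxK]
        refine abs_gapLinear_sub_lt hK hxK hy ⟨hx.1, by linarith [(abs_lt.1 hxd).2]⟩ ?_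
        rintro z ⟨hz, hz1, hz2⟩
        have := H hz (by rw [Real.dist_eq, abs_lt]; constructor <;> linarith)
        rwa [Real.dist_eq] at this
      · push Not at hacc
        obtain ⟨δ, hδ, H⟩ := hacc
        have hm0 : 0 < min δ (q - x₀) := lt_min hδ (by linarith)
        have hm1 := min_le_left δ (q - x₀)
        have hm2 := min_le_right δ (q - x₀)
        set m := min δ (q - x₀)
        obtain ⟨l, hl, r, hr, hgap, hxlr, hpl, hrq⟩ := exists_gap hK hxK hq
          (x := x₀ + m / 2) ⟨by linarith, by linarith⟩
        have hlx : x₀ = l := by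
          refine le_antisymm hpl (not_lt.1 fun h => ?_)
          linarith [H l hl h, hxlr.1]
        subst hlx
        have hc := continuousOn_gapLinear_gap (g := g) hl hr hgap x₀ ⟨le_rfl, by linarith [hxlr.2]⟩
        refine hc.mono_of_mem_nhdsWithin ?_
        refine mem_nhdsWithin.2 ⟨Iio r, isOpen_Iio, mem_Iio.2 (by linarith [hxlr.2]), ?_⟩
        exact fun y hy => ⟨hy.2.1, le_of_lt hy.1⟩
    have := hleft.union hright
    rwa [Icc_union_Icc_eq_Icc hx₀.1 hx₀.2] at this
  · obtain ⟨l, hl, r, hr, hgap, hxlr, -, -⟩ := exists_gap hK hp hq hx₀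
    have h1 : l < x₀ := lt_of_le_of_ne hxlr.1 fun h => hxK (h ▸ hl)
    have h2 : x₀ < r := lt_of_le_of_ne hxlr.2 fun h => hxK (h ▸ hr)
    exact ((continuousOn_gapLinear_gap hl hr hgap).continuousAt
      (Icc_mem_nhds h1 h2)).continuousWithinAt

/-- The continuous representative of an element of `(C[0,1])_μ^b` that is linear on every interval
of `[0,1] ∖ supp μ`. Pointwise evaluation always refers to this representative. -/
noncomputable def rep {μ : Measure ℝ} {b : BC} (f : CSpace μ b) : ℝ → ℝ :=
  gapLinear μ.support f.2.choose

theorem coe_ae_eq_rep {μ : Measure ℝ} {b : BC} (f : CSpace μ b) : f.1 =ᵐ[μ] rep f := by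
  filter_upwards [f.2.choose_spec.2.2, Measure.support_mem_ae (μ := μ)] with x hx hxs
  rw [hx]
  exact (gapLinear_of_mem hxs).symm

section Rep

variable {μ : Measure ℝ} [Admissible μ] {b : BC}

theorem continuousOn_rep (f : CSpace μ b) : ContinuousOn (rep f) (Icc 0 1) :=
  continuousOn_gapLinear Measure.isClosed_support Admissible.zero_mem Admissible.one_mem
    (f.2.choose_spec.1.mono support_subset)

theorem rep_vanish (f : CSpace μ b) : b.Vanish (rep f) := by
  have h := f.2.choose_spec.2.1
  cases b
  · trivial
  · exact ⟨(gapLinear_of_mem (Admissible.zero_mem (μ := μ))).trans h.1,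
      (gapLinear_of_mem (Admissible.one_mem (μ := μ))).trans h.2⟩

end Rep

/-- The norm of `(C[0,1])_μ^b`, the supremum of `|f|` over `supp μ`. -/
noncomputable def supNorm {μ : Measure ℝ} {b : BC} (f : CSpace μ b) : ℝ :=
  ⨆ x : μ.support, |rep f x|

/-- The map `(C[0,1])_μ^b → (C[0,1])_ν^b` which sends `f` to the `L²(ν)`-class of the continuous
representative of `f` that is linear on every interval of `[0,1] ∖ supp μ`. -/
noncomputable def embed {μ : Measure ℝ} [Admissible μ] (ν : Measure ℝ) [Admissible ν] {b : BC}
    (f : CSpace μ b) : CSpace ν b :=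
  ⟨(memLp_of_continuousOn (continuousOn_rep f)).toLp (rep f),
    rep f, continuousOn_rep f, rep_vanish f, MemLp.coeFn_toLp _⟩

/-! ### The Krein-Feller operators -/

/-- `f ∈ C¹([0,1])` and `f'` has the `μ`-derivative `v`, that is,
`f'(x) = f'(0) + ∫₀ˣ v dμ` for all `x ∈ [0,1]` (one-sided derivatives at the end points). -/
def HasMuLaplacian (μ : Measure ℝ) (f v : ℝ → ℝ) : Prop :=
  ContDiffOn ℝ 1 f (Icc 0 1) ∧ ∀ x ∈ Icc (0 : ℝ) 1,
    derivWithin f (Icc 0 1) x = derivWithin f (Icc 0 1) 0 + ∫ y in (0 : ℝ)..x, v y ∂μ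

/-- The boundary conditions: `f'(0) = f'(1) = 0` (Neumann), `f(0) = f(1) = 0` (Dirichlet). -/
def BC.Holds : BC → (ℝ → ℝ) → Prop
  | .neumann, f => derivWithin f (Icc 0 1) 0 = 0 ∧ derivWithin f (Icc 0 1) 1 = 0
  | .dirichlet, f => f 0 = 0 ∧ f 1 = 0

theorem eq_zero_of_setIntegral_Iic {μ : Measure ℝ} [IsProbabilityMeasure μ] {v : ℝ → ℝ}
    (hv : Integrable v μ) (h : ∀ x, ∫ y in Iic x, v y ∂μ = 0) (huniv : ∫ y, v y ∂μ = 0) :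
    v =ᵐ[μ] 0 := by
  refine hv.ae_eq_zero_of_forall_setIntegral_eq_zero fun s hs _ => ?_
  induction s, hs using MeasurableSpace.induction_on_inter (borel_eq_generateFrom_Iic ℝ)
    isPiSystem_Iic with
  | empty => simp
  | basic t ht => obtain ⟨x, rfl⟩ := ht; exact h x
  | compl t ht ih =>
    have := integral_add_compl ht hv
    rw [ih (measure_lt_top _ _), huniv] at this
    linarith
  | iUnion f hd hm ih =>
    rw [integral_iUnion hm hd hv.integrableOn]
    simp [fun i => ih i (measure_lt_top _ _)]

/-- The `μ`-Laplacian of a function depends only on its `L²(μ)`-class. -/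
theorem HasMuLaplacian.eq_zero {μ : Measure ℝ} [Admissible μ] {f v : ℝ → ℝ}
    (h : HasMuLaplacian μ f v) (hv : Integrable v μ) (hf : f =ᵐ[μ] 0) : v =ᵐ[μ] 0 := by
  have hcont := h.1.continuousOn
  have hsupp : ∀ x ∈ μ.support, derivWithin f (Icc 0 1) x = 0 := by
    intro x hx
    have hd := (h.1.differentiableOn one_ne_zero x (support_subset hx)).hasDerivWithinAt
    rw [hasDerivWithinAt_iff_tendsto_slope] at hd
    by_contra hne
    have hev := hd.eventually_ne hne
    obtain ⟨U, hU, hUs⟩ := mem_nhdsWithin_iff_exists_mem_nhds_inter.1 hev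
    obtain ⟨y, hyU, hyx, hys⟩ := exists_mem_support_ne hx hU
    refine hUs ⟨hyU, support_subset hys, hyx⟩ ?_
    simp [slope, eq_zero_on_support hcont hf hx, eq_zero_on_support hcont hf hys]
  have hI : ∀ x ∈ Icc (0 : ℝ) 1, ∫ y in (0 : ℝ)..x, v y ∂μ = 0 := by
    intro x hx
    obtain ⟨l, hl, r, hr, hgap, hxlr, -, -⟩ := exists_gap (Measure.isClosed_support (μ := μ))
      Admissible.zero_mem Admissible.one_mem hx
    have h0 := hsupp 0 Admissible.zero_mem
    have h1 : ∫ y in (0 : ℝ)..l, v y ∂μ = 0 := by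
      have := h.2 l (support_subset hl)
      rw [hsupp l hl, h0] at this
      linarith
    have h2 : ∫ y in l..x, v y ∂μ = 0 := by
      rw [intervalIntegral.integral_of_le hxlr.1, integral_Ioc_eq_integral_Ioo]
      refine setIntegral_measure_zero _ (measure_mono_null (t := μ.supportᶜ) ?_
        Measure.measure_compl_support)
      intro y hy hys
      rcases hgap y hys with h | h
      · exact absurd h (not_le.2 hy.1)
      · exact absurd (hy.2.trans_le hxlr.2) (not_lt.2 h)
    rw [← intervalIntegral.integral_add_adjacent_intervals (b := l)
      hv.intervalIntegrable hv.intervalIntegrable, h1, h2, add_zero]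
  have hIic : ∀ x, ∫ y in Iic x, v y ∂μ = ∫ y in (0 : ℝ)..(max 0 (min x 1)), v y ∂μ := by
    intro x
    rw [intervalIntegral.integral_of_le (le_max_left _ _), ← integral_Icc_eq_integral_Ioc]
    rcases lt_or_ge x 0 with hx | hx
    · have e1 : ∫ y in Iic x, v y ∂μ = 0 := setIntegral_measure_zero _
        (measure_mono_null (t := (Icc 0 1)ᶜ)
          (fun y (hy : y ≤ x) (hyI : y ∈ Icc (0 : ℝ) 1) =>
            absurd hyI.1 (not_le.2 (hy.trans_lt hx))) Admissible.null_compl)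
      rw [e1, max_eq_left ((min_le_left _ _).trans hx.le)]
      simp
    · rw [max_eq_right (le_min hx zero_le_one)]
      refine setIntegral_congr_set ?_
      have : ∀ᵐ y ∂μ, y ∈ Icc (0 : ℝ) 1 := mem_ae_iff.2 (Admissible.null_compl (μ := μ))
      filter_upwards [this] with y hy
      refine propext ⟨fun h => ⟨hy.1, le_min h hy.2⟩, fun h => h.2.trans (min_le_left _ _)⟩
  have hz : ∀ x, ∫ y in Iic x, v y ∂μ = 0 := fun x => by
    rw [hIic]
    exact hI _ ⟨le_max_left _ _, max_le zero_le_one (min_le_right _ _)⟩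
  refine eq_zero_of_setIntegral_Iic hv hz ?_
  rw [← hz 1]
  refine (setIntegral_eq_integral_of_ae_compl_eq_zero ?_).symm
  have : ∀ᵐ y ∂μ, y ∈ Icc (0 : ℝ) 1 := mem_ae_iff.2 (Admissible.null_compl (μ := μ))
  filter_upwards [this] with y hy hn using absurd hy.2 hn

theorem integrable_coe {μ : Measure ℝ} [Admissible μ] (v : Lp ℝ 2 μ) : Integrable v μ :=
  (Lp.memLp v).integrable (by norm_num)

/-- The graph of `Δ_μ^b`: all pairs `(u, v)` in `L²(μ) × L²(μ)` such that `u` has a representative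
`f ∈ C¹([0,1])` which satisfies the boundary conditions and whose derivative has the
`μ`-derivative `v`. -/
def laplacianGraph (μ : Measure ℝ) [Admissible μ] (b : BC) :
    Submodule ℝ (Lp ℝ 2 μ × Lp ℝ 2 μ) where
  carrier := {p | ∃ f : ℝ → ℝ, HasMuLaplacian μ f p.2 ∧ b.Holds f ∧ p.1 =ᵐ[μ] f}
  zero_mem' := by
    refine ⟨fun _ => 0, ⟨contDiffOn_const, fun x hx => ?_⟩, ?_, Lp.coeFn_zero ℝ 2 μ⟩
    · simp
    · cases b <;> simp [BC.Holds]
  add_mem' := by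
    rintro ⟨u₁, v₁⟩ ⟨u₂, v₂⟩ ⟨f₁, ⟨hc₁, hd₁⟩, hb₁, h₁⟩ ⟨f₂, ⟨hc₂, hd₂⟩, hb₂, h₂⟩
    have hder : ∀ x ∈ Icc (0 : ℝ) 1, derivWithin (f₁ + f₂) (Icc 0 1) x =
        derivWithin f₁ (Icc 0 1) x + derivWithin f₂ (Icc 0 1) x := fun x hx =>
      derivWithin_add (hc₁.differentiableOn one_ne_zero x hx)
        (hc₂.differentiableOn one_ne_zero x hx)
    have h0 : (0 : ℝ) ∈ Icc (0 : ℝ) 1 := by simp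
    have h1 : (1 : ℝ) ∈ Icc (0 : ℝ) 1 := by simp
    refine ⟨f₁ + f₂, ⟨hc₁.add hc₂, fun x hx => ?_⟩, ?_, (Lp.coeFn_add u₁ u₂).trans (h₁.add h₂)⟩
    · have : ∫ y in (0 : ℝ)..x, (v₁ + v₂ : Lp ℝ 2 μ) y ∂μ =
          ∫ y in (0 : ℝ)..x, v₁ y ∂μ + ∫ y in (0 : ℝ)..x, v₂ y ∂μ := by
        rw [← intervalIntegral.integral_add (integrable_coe v₁).intervalIntegrable
          (integrable_coe v₂).intervalIntegrable]
        refine intervalIntegral.integral_congr_ae ?_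
        filter_upwards [Lp.coeFn_add v₁ v₂] with y hy _ using hy
      rw [hder x hx, hder 0 h0, hd₁ x hx, hd₂ x hx]
      refine Eq.trans ?_ (congrArg _ this.symm)
      ring
    · cases b
      · exact ⟨by rw [hder 0 h0, hb₁.1, hb₂.1, add_zero], by rw [hder 1 h1, hb₁.2, hb₂.2, add_zero]⟩
      · exact ⟨by simp [hb₁.1, hb₂.1], by simp [hb₁.2, hb₂.2]⟩
  smul_mem' := by
    rintro c ⟨u, v⟩ ⟨f, ⟨hc, hd⟩, hb, h⟩
    have hder : ∀ x ∈ Icc (0 : ℝ) 1, derivWithin (c • f) (Icc 0 1) x =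
        c * derivWithin f (Icc 0 1) x := fun x hx =>
      derivWithin_const_smul c (hc.differentiableOn one_ne_zero x hx)
    have h0 : (0 : ℝ) ∈ Icc (0 : ℝ) 1 := by simp
    have h1 : (1 : ℝ) ∈ Icc (0 : ℝ) 1 := by simp
    refine ⟨c • f, ⟨hc.const_smul c, fun x hx => ?_⟩, ?_,
      (Lp.coeFn_smul c u).trans (h.const_smul c)⟩
    · have : ∫ y in (0 : ℝ)..x, (c • v : Lp ℝ 2 μ) y ∂μ = c * ∫ y in (0 : ℝ)..x, v y ∂μ := by
        rw [← intervalIntegral.integral_const_mul]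
        refine intervalIntegral.integral_congr_ae ?_
        filter_upwards [Lp.coeFn_smul c v] with y hy _ using hy
      rw [hder x hx, hder 0 h0, hd x hx]
      refine Eq.trans ?_ (congrArg _ this.symm)
      ring
    · cases b
      · exact ⟨by rw [hder 0 h0, hb.1, mul_zero], by rw [hder 1 h1, hb.2, mul_zero]⟩
      · exact ⟨by simp [hb.1], by simp [hb.2]⟩

/-- The Krein-Feller operator `Δ_μ^b` as an unbounded operator on `L²(μ)`. -/
noncomputable def laplacian (μ : Measure ℝ) [Admissible μ] (b : BC) :
    Lp ℝ 2 μ →ₗ.[ℝ] Lp ℝ 2 μ :=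
  (laplacianGraph μ b).toLinearPMap

theorem laplacian_graph (μ : Measure ℝ) [Admissible μ] (b : BC) :
    (laplacian μ b).graph = laplacianGraph μ b := by
  refine Submodule.toLinearPMap_graph_eq _ ?_
  rintro ⟨u, v⟩ ⟨f, hf, -, h⟩ hu
  refine Lp.eq_zero_iff_ae_eq_zero.2 (hf.eq_zero (integrable_coe v) (h.symm.trans ?_))
  simp only at hu
  rw [hu]
  exact Lp.coeFn_zero ℝ 2 μ

theorem laplacian_domain_le (μ : Measure ℝ) [Admissible μ] (b : BC) :
    (laplacian μ b).domain ≤ CSpace μ b := by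
  rintro _ ⟨⟨u, v⟩, ⟨f, hf, hb, h⟩, rfl⟩
  refine ⟨f, hf.1.continuousOn, ?_, h⟩
  cases b
  · trivial
  · exact hb

/-- The operator `c - Δ_μ^b` on the domain of `Δ_μ^b`. -/
noncomputable def shifted (μ : Measure ℝ) [Admissible μ] (b : BC) (c : ℝ) :
    (laplacian μ b).domain → Lp ℝ 2 μ :=
  fun u => c • (u : Lp ℝ 2 μ) - laplacian μ b u

/-- The resolvent operator `R_c^b = (c - Δ_μ^b)⁻¹` on `L²(μ)` (meaningful when `c - Δ_μ^b` is a
bijection of the domain of `Δ_μ^b` onto `L²(μ)`). -/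
noncomputable def resolvent (μ : Measure ℝ) [Admissible μ] (b : BC) (c : ℝ) :
    Lp ℝ 2 μ → (laplacian μ b).domain :=
  Function.invFun (shifted μ b c)

/-- The resolvent operator applied to, and with values in, the space `(C[0,1])_μ^b`. -/
noncomputable def resolventC (μ : Measure ℝ) [Admissible μ] (b : BC) (c : ℝ) (f : CSpace μ b) :
    CSpace μ b :=
  Submodule.inclusion (laplacian_domain_le μ b) (resolvent μ b c f)

/-- The measure as a point of the space of Borel probability measures on `ℝ`, which carries the
topology of weak convergence. -/
def toProb (μ : Measure ℝ) [Admissible μ] : ProbabilityMeasure ℝ := ⟨μ, inferInstance⟩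

end KreinFeller

/-!
Integrating twice, `(c - Δ_ν^b) u = g` becomes `u = s q + V_ν (c u - g)` together with the boundary
condition at `1`, where `V_ν u (x) = ∫ (x - y)⁺ u(y) dν(y)`, `q = 1` (Neumann) or `q = x`
(Dirichlet), and `s` is a free parameter. The equation `u = h + c V_ν u` is uniquely solvable and
obeys a Gronwall bound that depends only on `c`, not on `ν`. If `w` and `φ` are the solutions for
`h = -V_ν g` and `h = q`, then `u = w + s φ`, and `s` is determined by the condition at `1` because
the contribution of `φ` there is positive.

If `ν_n → ν` weakly, then `V_{ν_n} G → V_ν G` pointwise for continuous `G`, and uniformly because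
these functions are equi-Lipschitz. By the uniform Gronwall bound the functions `w`, `φ`, hence also
`s` and `u`, converge uniformly on `[0,1]`, on the gaps of the supports as well.
-/

namespace KreinFeller

/-- The Volterra operator `u ↦ (x ↦ ∫ (x - y)⁺ u(y) dν(y))`, the inverse of `f ↦ (f')^ν` under zero
initial conditions. -/
noncomputable def volterra (ν : Measure ℝ) (u : ℝ → ℝ) (x : ℝ) : ℝ :=
  ∫ y, max (x - y) 0 * u y ∂ν

theorem volterra_congr_ae {ν : Measure ℝ} {u v : ℝ → ℝ} (h : u =ᵐ[ν] v) :
    volterra ν u = volterra ν v :=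
  funext fun _ => integral_congr_ae (h.mono fun y hy => by simp only [hy])

theorem volterra_const_mul (ν : Measure ℝ) (s : ℝ) (u : ℝ → ℝ) (x : ℝ) :
    volterra ν (fun y => s * u y) x = s * volterra ν u x := by
  simp only [volterra, mul_left_comm _ s, integral_const_mul]

theorem abs_volterra_le (ν : Measure ℝ) (u : ℝ → ℝ) (x : ℝ) :
    |volterra ν u x| ≤ volterra ν (fun y => |u y|) x := by
  refine abs_integral_le_integral_abs.trans_eq ?_
  simp only [volterra, abs_mul, abs_of_nonneg (le_max_right _ (0 : ℝ))]

theorem gapLinear_convexComb {K : Set ℝ} {g : ℝ → ℝ} {l r t : ℝ} (hl : l ∈ K) (hr : r ∈ K)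
    (hgap : ∀ y ∈ K, y ≤ l ∨ r ≤ y) (hlr : l ≤ r) (ht : t ∈ Icc (0 : ℝ) 1) :
    gapLinear K g ((1 - t) * l + t * r) = (1 - t) * g l + t * g r := by
  rcases hlr.eq_or_lt with rfl | hlt
  · have hl' : (1 - t) * l + t * l = l := by ring
    rw [hl', gapLinear_of_mem hl]
    ring
  · have hx : (1 - t) * l + t * r ∈ Icc l r := by
      constructor <;> nlinarith [mul_nonneg ht.1 (sub_nonneg.2 hlr),
        mul_nonneg (sub_nonneg.2 ht.2) (sub_nonneg.2 hlr)]
    have ht' : ((1 - t) * l + t * r - l) / (r - l) = t := by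
      rw [div_eq_iff (sub_pos.2 hlt).ne']
      ring
    rw [gapLinear_of_gap hl hr hgap hx, ht']
    ring

section Volterra

variable {ν : Measure ℝ} [Admissible ν] {u v : ℝ → ℝ}

theorem ae_mem_Icc : ∀ᵐ y ∂ν, y ∈ Icc (0 : ℝ) 1 :=
  mem_ae_iff.2 Admissible.null_compl

theorem integrable_of_continuousOn (hu : ContinuousOn u (Icc 0 1)) : Integrable u ν :=
  (memLp_of_continuousOn hu).integrable one_le_two

theorem integrable_kernel_mul (hu : Integrable u ν) (x : ℝ) :
    Integrable (fun y => max (x - y) 0 * u y) ν := by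
  refine hu.bdd_mul (c := |x|) (by fun_prop) ?_
  filter_upwards [ae_mem_Icc (ν := ν)] with y hy
  rw [Real.norm_of_nonneg (le_max_right _ _)]
  exact max_le (by linarith [hy.1, le_abs_self x]) (abs_nonneg x)

theorem volterra_add (hu : Integrable u ν) (hv : Integrable v ν) (x : ℝ) :
    volterra ν (fun y => u y + v y) x = volterra ν u x + volterra ν v x := by
  simp only [volterra, mul_add]
  exact integral_add (integrable_kernel_mul hu x) (integrable_kernel_mul hv x)

theorem volterra_sub (hu : Integrable u ν) (hv : Integrable v ν) (x : ℝ) :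
    volterra ν (fun y => u y - v y) x = volterra ν u x - volterra ν v x := by
  simp only [volterra, mul_sub]
  exact integral_sub (integrable_kernel_mul hu x) (integrable_kernel_mul hv x)

theorem volterra_mono (hu : Integrable u ν) (hv : Integrable v ν)
    (huv : ∀ y ∈ Icc (0 : ℝ) 1, u y ≤ v y) (x : ℝ) : volterra ν u x ≤ volterra ν v x := by
  refine integral_mono_ae (integrable_kernel_mul hu x) (integrable_kernel_mul hv x) ?_
  filter_upwards [ae_mem_Icc (ν := ν)] with y hy
  exact mul_le_mul_of_nonneg_left (huv y hy) (le_max_right _ _)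

theorem volterra_zero_right : volterra ν u 0 = 0 := by
  refine integral_eq_zero_of_ae ?_
  filter_upwards [ae_mem_Icc (ν := ν)] with y hy
  simp [hy.1]

theorem lipschitzWith_kernel_mul (y r : ℝ) :
    LipschitzWith (Real.nnabs r) fun x => max (x - y) 0 * r := by
  refine LipschitzWith.of_dist_le_mul fun x x' => ?_
  rw [Real.dist_eq, Real.dist_eq, ← sub_mul, abs_mul, mul_comm, Real.coe_nnabs]
  refine mul_le_mul_of_nonneg_left ?_ (abs_nonneg r)
  simpa only [sub_sub_sub_cancel_right] using abs_max_sub_max_le_abs (x - y) (x' - y) 0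

theorem hasDerivAt_kernel_mul {x y : ℝ} (hxy : y ≠ x) (r : ℝ) :
    HasDerivAt (fun x => max (x - y) 0 * r) ((Iio x).indicator (fun _ => r) y) x := by
  rcases hxy.lt_or_gt with h | h
  · have : HasDerivAt (fun x => (x - y) * r) r x := by
      simpa using ((hasDerivAt_id x).sub_const y).mul_const r
    rw [indicator_of_mem (mem_Iio.2 h)]
    refine this.congr_of_eventuallyEq ?_
    filter_upwards [lt_mem_nhds h] with z hz
    rw [max_eq_left (sub_nonneg.2 hz.le)]
  · rw [indicator_of_notMem (notMem_Iio.2 h.le)]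
    refine (hasDerivAt_const x 0).congr_of_eventuallyEq ?_
    filter_upwards [gt_mem_nhds h] with z hz
    rw [max_eq_right (sub_nonpos.2 hz.le), zero_mul]

theorem hasDerivAt_volterra (hu : Integrable u ν) (x : ℝ) :
    HasDerivAt (volterra ν u) (∫ y in Iio x, u y ∂ν) x := by
  rw [← integral_indicator measurableSet_Iio]
  refine (hasDerivAt_integral_of_dominated_loc_of_lip (bound := fun y => |u y|) univ_mem
    (.of_forall fun z => (integrable_kernel_mul hu z).aestronglyMeasurable)
    (integrable_kernel_mul hu x) (hu.indicator measurableSet_Iio).aestronglyMeasurable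
    (.of_forall fun y => ?_) hu.abs ?_).2
  · rw [Real.nnabs_of_nonneg (abs_nonneg _), Real.toNNReal_abs]
    exact (lipschitzWith_kernel_mul y (u y)).lipschitzOnWith
  · filter_upwards [compl_mem_ae_iff.2 (measure_singleton (μ := ν) x)] with y hy
    exact hasDerivAt_kernel_mul hy (u y)

theorem setIntegral_Iio_eq_intervalIntegral {x : ℝ} (hx : 0 ≤ x) :
    ∫ y in Iio x, u y ∂ν = ∫ y in (0 : ℝ)..x, u y ∂ν := by
  rw [intervalIntegral.integral_of_le hx, integral_Ioc_eq_integral_Ioo,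
    ← integral_Ico_eq_integral_Ioo]
  refine setIntegral_congr_set ?_
  filter_upwards [ae_mem_Icc (ν := ν)] with y hy
  exact propext ⟨fun h => ⟨hy.1, h⟩, fun h => h.2⟩

theorem continuous_volterra (hu : Integrable u ν) : Continuous (volterra ν u) :=
  continuous_iff_continuousAt.2 fun x => (hasDerivAt_volterra hu x).continuousAt

theorem lipschitzWith_volterra {B : NNReal} (hu : ContinuousOn u (Icc 0 1))
    (hB : ∀ y ∈ Icc (0 : ℝ) 1, |u y| ≤ B) : LipschitzWith B (volterra ν u) := by
  have hd := hasDerivAt_volterra (ν := ν) (integrable_of_continuousOn hu)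
  refine lipschitzWith_of_nnnorm_deriv_le (fun x => (hd x).differentiableAt) fun x => ?_
  rw [(hd x).deriv, ← NNReal.coe_le_coe, coe_nnnorm]
  refine (norm_setIntegral_le_of_norm_le_const_ae' (measure_lt_top ν _) ?_).trans
    (mul_le_of_le_one_right B.coe_nonneg measureReal_le_one)
  filter_upwards [ae_mem_Icc (ν := ν)] with y hy _ using hB y hy

theorem derivWithin_of_eqOn_add_volterra {f : ℝ → ℝ} {p q : ℝ} (hv : Integrable v ν)
    (hf : EqOn f (fun x => p + q * x + volterra ν v x) (Icc 0 1)) {x : ℝ}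
    (hx : x ∈ Icc (0 : ℝ) 1) :
    derivWithin f (Icc 0 1) x = q + ∫ y in (0 : ℝ)..x, v y ∂ν := by
  have hd : HasDerivAt (fun x => p + q * x + volterra ν v x) (q + ∫ y in Iio x, v y ∂ν) x := by
    simpa using (((hasDerivAt_id x).const_mul q).const_add p).fun_add
      (hasDerivAt_volterra hv x)
  rw [derivWithin_congr hf (hf hx), ← setIntegral_Iio_eq_intervalIntegral hx.1]
  exact hd.hasDerivWithinAt.derivWithin (uniqueDiffOn_Icc zero_lt_one x hx)

theorem hasMuLaplacian_of_eqOn {f : ℝ → ℝ} {p q : ℝ} (hv : Integrable v ν)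
    (hf : EqOn f (fun x => p + q * x + volterra ν v x) (Icc 0 1)) : HasMuLaplacian ν f v := by
  have hd {x : ℝ} (hx : x ∈ Icc (0 : ℝ) 1) := derivWithin_of_eqOn_add_volterra hv hf hx
  refine ⟨(contDiffOn_one_iff_derivWithin (uniqueDiffOn_Icc zero_lt_one)).2 ⟨?_, ?_⟩,
    fun x hx => ?_⟩
  · refine DifferentiableOn.congr (fun x _ => ?_) hf
    have hV := (hasDerivAt_volterra hv x).differentiableAt
    exact DifferentiableAt.differentiableWithinAt (by fun_prop)
  · refine ContinuousOn.congr (Continuous.continuousOn ?_) fun x hx => hd hx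
    exact continuous_const.add
      (intervalIntegral.continuous_primitive (fun _ _ => hv.intervalIntegrable) 0)
  · rw [hd hx, hd (left_mem_Icc.2 zero_le_one), intervalIntegral.integral_same, add_zero]

theorem HasMuLaplacian.eqOn {f : ℝ → ℝ} (hf : HasMuLaplacian ν f v) (hv : Integrable v ν) :
    EqOn f (fun x => f 0 + derivWithin f (Icc 0 1) 0 * x + volterra ν v x) (Icc 0 1) := by
  have hg := hasMuLaplacian_of_eqOn (ν := ν) (p := f 0) (q := derivWithin f (Icc 0 1) 0) hv
    (eqOn_refl _ _)
  refine eq_of_derivWithin_eq (hf.1.differentiableOn one_ne_zero)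
    (hg.1.differentiableOn one_ne_zero) (fun x hx => ?_) (by simp [volterra_zero_right])
  have hx' := Ico_subset_Icc_self hx
  rw [hf.2 x hx', derivWithin_of_eqOn_add_volterra hv (eqOn_refl _ _) hx']

theorem volterra_convexComb {l r : ℝ} (hv : Integrable v ν)
    (hgap : ∀ y ∈ ν.support, y ≤ l ∨ r ≤ y) (hlr : l ≤ r) {t : ℝ} (ht : t ∈ Icc (0 : ℝ) 1) :
    volterra ν v ((1 - t) * l + t * r) = (1 - t) * volterra ν v l + t * volterra ν v r := by
  simp only [volterra, ← integral_const_mul]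
  rw [← integral_add ((integrable_kernel_mul hv l).const_mul _)
    ((integrable_kernel_mul hv r).const_mul _)]
  refine integral_congr_ae ?_
  filter_upwards [Measure.support_mem_ae (μ := ν)] with y hy
  have hl : 0 ≤ (1 - t) * (r - l) := mul_nonneg (sub_nonneg.2 ht.2) (sub_nonneg.2 hlr)
  have hr : 0 ≤ t * (r - l) := mul_nonneg ht.1 (sub_nonneg.2 hlr)
  rcases hgap y hy with h | h
  · rw [max_eq_left (by linarith), max_eq_left (by linarith), max_eq_left (by linarith)]
    ring
  · rw [max_eq_right (by linarith), max_eq_right (by linarith), max_eq_right (by linarith)]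
    ring

theorem HasMuLaplacian.eqOn_gapLinear {f : ℝ → ℝ} (hf : HasMuLaplacian ν f v)
    (hv : Integrable v ν) : EqOn (gapLinear ν.support f) f (Icc 0 1) := by
  intro x hx
  obtain ⟨l, hl, r, hr, hgap, hxlr, -, -⟩ :=
    exists_gap Measure.isClosed_support (Admissible.zero_mem (μ := ν)) Admissible.one_mem hx
  have hlr : l ≤ r := hxlr.1.trans hxlr.2
  obtain ⟨t, ht, rfl⟩ : ∃ t ∈ Icc (0 : ℝ) 1, (1 - t) * l + t * r = x := by
    simpa [segment_eq_image] using (segment_eq_Icc hlr).ge hxlr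
  rw [gapLinear_convexComb hl hr hgap hlr ht, hf.eqOn hv hx, hf.eqOn hv (support_subset hl),
    hf.eqOn hv (support_subset hr)]
  simp only [volterra_convexComb hv hgap hlr ht]
  ring

end Volterra

/-- `u` is a continuous solution on `[0,1]` of the Volterra equation `u = h + c V_ν u`. -/
structure IsVolterraSol (ν : Measure ℝ) (c : ℝ) (h u : ℝ → ℝ) : Prop where
  continuousOn : ContinuousOn u (Icc 0 1)
  eq : ∀ x ∈ Icc (0 : ℝ) 1, u x = h x + c * volterra ν u x

section VolterraEquation

variable {ν : Measure ℝ} [Admissible ν] {c : ℝ} {h h' u u' : ℝ → ℝ}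

theorem mul_volterra_le_of_le_exp {d : ℝ → ℝ} {M : ℝ} (hc : 0 ≤ c) (hM : 0 ≤ M)
    (hd : ContinuousOn d (Icc 0 1)) (hdM : ∀ y ∈ Icc (0 : ℝ) 1, d y ≤ M * Real.exp (2 * c * y))
    (x : ℝ) : c * volterra ν d x ≤ M / 2 * Real.exp (2 * c * x) := by
  have hexp : c * volterra ν (fun y => M * Real.exp (2 * c * y)) x ≤
      ∫ _, M / 2 * Real.exp (2 * c * x) ∂ν := by
    rw [volterra, ← integral_const_mul]
    refine integral_mono ((integrable_kernel_mul (integrable_of_continuousOn (by fun_prop))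
      x).const_mul c) (integrable_const _) fun y => ?_
    have key : 2 * c * max (x - y) 0 * Real.exp (2 * c * y) ≤ Real.exp (2 * c * x) := by
      rcases le_total y x with hyx | hxy
      · rw [max_eq_left (sub_nonneg.2 hyx)]
        have := Real.add_one_le_exp (2 * c * (x - y))
        calc 2 * c * (x - y) * Real.exp (2 * c * y)
            ≤ Real.exp (2 * c * (x - y)) * Real.exp (2 * c * y) := by gcongr; linarith
          _ = Real.exp (2 * c * x) := by rw [← Real.exp_add]; ring_nf
      · simp [max_eq_right (sub_nonpos.2 hxy), Real.exp_nonneg]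
    linarith [mul_le_mul_of_nonneg_left key hM]
  rw [integral_const, probReal_univ, one_smul] at hexp
  exact (mul_le_mul_of_nonneg_left (volterra_mono (integrable_of_continuousOn hd)
    (integrable_of_continuousOn (by fun_prop)) hdM x) hc).trans hexp

theorem le_exp_of_le_add_mul_volterra {d : ℝ → ℝ} {ε : ℝ} (hc : 0 ≤ c) (hε : 0 ≤ ε)
    (hd : ContinuousOn d (Icc 0 1)) (hle : ∀ x ∈ Icc (0 : ℝ) 1, d x ≤ ε + c * volterra ν d x)
    {x : ℝ} (hx : x ∈ Icc (0 : ℝ) 1) : d x ≤ 2 * ε * Real.exp (2 * c * x) := by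
  -- At a maximum point `z` of `d e^(-2cy)`, the weight halves the Volterra term: `M ≤ ε + M / 2`.
  obtain ⟨z, hz, hmax⟩ := isCompact_Icc.exists_isMaxOn (nonempty_Icc.2 zero_le_one)
    (f := fun y => d y * Real.exp (-(2 * c * y))) (by fun_prop)
  set M := d z * Real.exp (-(2 * c * z))
  have hM : ∀ y ∈ Icc (0 : ℝ) 1, d y ≤ M * Real.exp (2 * c * y) := fun y hy => by
    rw [← div_le_iff₀ (Real.exp_pos _), div_eq_mul_inv, ← Real.exp_neg]
    exact hmax hy
  have hMε : M ≤ 2 * ε := by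
    by_contra! hlt
    have h1 := mul_volterra_le_of_le_exp (ν := ν) hc (by linarith) hd hM z
    have h2 : d z = M * Real.exp (2 * c * z) := by
      rw [mul_assoc, ← Real.exp_add, neg_add_cancel, Real.exp_zero, mul_one]
    have h3 := hle z hz
    have h4 : 1 ≤ Real.exp (2 * c * z) := Real.one_le_exp (mul_nonneg (by linarith) hz.1)
    nlinarith
  exact (hM x hx).trans (mul_le_mul_of_nonneg_right hMε (Real.exp_nonneg _))

namespace IsVolterraSol

theorem integrable (hu : IsVolterraSol ν c h u) : Integrable u ν :=
  integrable_of_continuousOn hu.continuousOn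

theorem add_const_mul (hu : IsVolterraSol ν c h u) (hu' : IsVolterraSol ν c h' u') (s : ℝ) :
    IsVolterraSol ν c (fun x => h x + s * h' x) fun x => u x + s * u' x := by
  refine ⟨hu.continuousOn.add (hu'.continuousOn.const_mul s), fun x hx => ?_⟩
  rw [volterra_add hu.integrable (hu'.integrable.const_mul s), volterra_const_mul,
    hu.eq x hx, hu'.eq x hx]
  ring

theorem sub (hu : IsVolterraSol ν c h u) (hu' : IsVolterraSol ν c h' u') :
    IsVolterraSol ν c (fun x => h x - h' x) fun x => u x - u' x := by
  simpa [sub_eq_add_neg] using hu.add_const_mul hu' (-1)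

theorem abs_le {ε : ℝ} (hu : IsVolterraSol ν c h u) (hh : ∀ x ∈ Icc (0 : ℝ) 1, |h x| ≤ ε)
    {x : ℝ} (hx : x ∈ Icc (0 : ℝ) 1) : |u x| ≤ 2 * ε * Real.exp (2 * |c|) := by
  have hε : 0 ≤ ε := (abs_nonneg _).trans (hh x hx)
  have hle : ∀ y ∈ Icc (0 : ℝ) 1, |u y| ≤ ε + |c| * volterra ν (fun z => |u z|) y := by
    intro y hy
    calc |u y| ≤ |h y| + |c * volterra ν u y| := hu.eq y hy ▸ abs_add_le _ _
      _ ≤ ε + |c| * volterra ν (fun z => |u z|) y := by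
        rw [abs_mul]
        gcongr
        exacts [hh y hy, abs_volterra_le ν u y]
  refine (le_exp_of_le_add_mul_volterra (abs_nonneg c) hε hu.continuousOn.abs hle hx).trans ?_
  have : 2 * |c| * x ≤ 2 * |c| := mul_le_of_le_one_right (by positivity) hx.2
  gcongr

theorem eqOn (hu : IsVolterraSol ν c h u) (hu' : IsVolterraSol ν c h u') :
    EqOn u u' (Icc 0 1) := by
  intro x hx
  have := (hu.sub hu').abs_le (ε := 0) (fun y _ => by simp) hx
  simpa [sub_eq_zero] using this

theorem congr (hu : IsVolterraSol ν c h u) (huu' : EqOn u' u (Icc 0 1)) :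
    IsVolterraSol ν c h u' := by
  refine ⟨hu.continuousOn.congr huu', fun x hx => ?_⟩
  rw [huu' hx, hu.eq x hx, volterra_congr_ae (ae_mem_Icc.mono fun y hy => huu' hy)]

theorem nonneg (hu : IsVolterraSol ν c h u) (hc : 0 ≤ c) (hh : ∀ x ∈ Icc (0 : ℝ) 1, 0 ≤ h x)
    {x : ℝ} (hx : x ∈ Icc (0 : ℝ) 1) : 0 ≤ u x := by
  have hle : ∀ y ∈ Icc (0 : ℝ) 1, -u y ≤ 0 + c * volterra ν (fun z => -u z) y := by
    intro y hy
    have := volterra_const_mul ν (-1) u y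
    simp only [neg_one_mul] at this
    rw [this, hu.eq y hy]
    linarith [hh y hy]
  simpa using le_exp_of_le_add_mul_volterra hc le_rfl hu.continuousOn.neg hle hx

theorem le (hu : IsVolterraSol ν c h u) (hc : 0 ≤ c) (hh : ∀ x ∈ Icc (0 : ℝ) 1, 0 ≤ h x)
    {x : ℝ} (hx : x ∈ Icc (0 : ℝ) 1) : h x ≤ u x := by
  have h0 : volterra ν 0 x ≤ volterra ν u x :=
    volterra_mono (integrable_zero _ _ _) hu.integrable (fun y hy => hu.nonneg hc hh hy) x
  have h1 : 0 ≤ volterra ν u x := by simpa [volterra] using h0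
  linarith [hu.eq x hx, mul_nonneg hc h1]

end IsVolterraSol

theorem abs_mul_volterra_le_of_le_exp {M : ℝ} (hu : ContinuousOn u (Icc 0 1))
    (huM : ∀ y ∈ Icc (0 : ℝ) 1, |u y| ≤ M * Real.exp (2 * |c| * y)) (x : ℝ) :
    |c * volterra ν u x| ≤ M / 2 * Real.exp (2 * |c| * x) := by
  have hM : 0 ≤ M := by simpa using (abs_nonneg _).trans (huM 0 (left_mem_Icc.2 zero_le_one))
  rw [abs_mul]
  exact (mul_le_mul_of_nonneg_left (abs_volterra_le ν u x) (abs_nonneg c)).trans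
    (mul_volterra_le_of_le_exp (abs_nonneg c) hM hu.abs huM x)

/-- The extension of `x ↦ e^{2|c|x} v(x)` from `[0,1]` to a continuous function on `ℝ`. The weight
is chosen so that `c V_ν` has norm at most `1/2` in the correspondingly weighted supremum norm. -/
noncomputable def weightedExtend (c : ℝ) (v : C(Icc (0 : ℝ) 1, ℝ)) (y : ℝ) : ℝ :=
  Real.exp (2 * |c| * y) * IccExtend zero_le_one v y

theorem continuous_weightedExtend (c : ℝ) (v : C(Icc (0 : ℝ) 1, ℝ)) :
    Continuous (weightedExtend c v) := by
  unfold weightedExtend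
  fun_prop

theorem integrable_weightedExtend (c : ℝ) (v : C(Icc (0 : ℝ) 1, ℝ)) :
    Integrable (weightedExtend c v) ν :=
  integrable_of_continuousOn (continuous_weightedExtend c v).continuousOn

/-- The map `u ↦ h + c V_ν u` on `C([0,1])`, conjugated by the weight of `weightedExtend`. -/
noncomputable def weightedPicard (ν : Measure ℝ) [Admissible ν] (c : ℝ)
    (hh : ContinuousOn h (Icc 0 1)) (v : C(Icc (0 : ℝ) 1, ℝ)) : C(Icc (0 : ℝ) 1, ℝ) where
  toFun x := Real.exp (-(2 * |c| * x)) * (h x + c * volterra ν (weightedExtend c v) x)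
  continuous_toFun := by
    have := continuousOn_iff_continuous_domRestrict.1 hh
    have := continuous_volterra (ν := ν) (integrable_weightedExtend c v)
    exact .mul (by fun_prop) (.add ‹_› (by fun_prop))

theorem contractingWith_weightedPicard (ν : Measure ℝ) [Admissible ν] (c : ℝ)
    (hh : ContinuousOn h (Icc 0 1)) : ContractingWith (1 / 2) (weightedPicard ν c hh) := by
  refine ⟨by norm_num, LipschitzWith.of_dist_le_mul fun v w => ?_⟩
  refine (ContinuousMap.dist_le (by positivity)).2 fun x => ?_
  have hvw : ∀ y ∈ Icc (0 : ℝ) 1, |weightedExtend c v y - weightedExtend c w y| ≤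
      dist v w * Real.exp (2 * |c| * y) := by
    intro y hy
    rw [weightedExtend, weightedExtend, ← mul_sub, abs_mul, Real.abs_exp, mul_comm,
      IccExtend_of_mem _ _ hy, IccExtend_of_mem _ _ hy]
    gcongr
    exact ContinuousMap.dist_apply_le_dist (f := v) (g := w) ⟨y, hy⟩
  have hV := abs_mul_volterra_le_of_le_exp (ν := ν) (c := c)
    ((continuous_weightedExtend c v).sub (continuous_weightedExtend c w)).continuousOn hvw x
  calc dist (weightedPicard ν c hh v x) (weightedPicard ν c hh w x)
      = Real.exp (-(2 * |c| * x)) *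
          |c * volterra ν (weightedExtend c v - weightedExtend c w) x| := by
        rw [Real.dist_eq, ← Real.abs_exp (-(2 * |c| * x)), ← abs_mul]
        simp only [weightedPicard, ContinuousMap.coe_mk, Pi.sub_def, volterra_sub
          (integrable_weightedExtend (ν := ν) c v) (integrable_weightedExtend c w)]
        ring_nf
    _ ≤ Real.exp (-(2 * |c| * x)) * (dist v w / 2 * Real.exp (2 * |c| * x)) :=
        mul_le_mul_of_nonneg_left hV (Real.exp_nonneg _)
    _ = (1 / 2 : NNReal) * dist v w := by
        rw [mul_left_comm, ← Real.exp_add, neg_add_cancel, Real.exp_zero]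
        push_cast
        ring

theorem exists_isVolterraSol (ν : Measure ℝ) [Admissible ν] (c : ℝ)
    (hh : ContinuousOn h (Icc 0 1)) : ∃ u, IsVolterraSol ν c h u := by
  obtain ⟨v, hv⟩ : ∃ v, weightedPicard ν c hh v = v :=
    ⟨_, (contractingWith_weightedPicard ν c hh).fixedPoint_isFixedPt⟩
  refine ⟨weightedExtend c v, (continuous_weightedExtend c v).continuousOn, fun x hx => ?_⟩
  have hvx : Real.exp (-(2 * |c| * x)) * (h x + c * volterra ν (weightedExtend c v) x) =
      v ⟨x, hx⟩ := DFunLike.congr_fun hv ⟨x, hx⟩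
  rw [weightedExtend, IccExtend_of_mem _ _ hx, ← hvx, ← mul_assoc, ← Real.exp_add,
    add_neg_cancel, Real.exp_zero, one_mul]

end VolterraEquation

/-- The affine function whose multiples are the affine functions that satisfy the boundary condition
at `0`. -/
def BC.profile : BC → ℝ → ℝ
  | .neumann, _ => 1
  | .dirichlet, x => x

/-- The quantity whose vanishing is the boundary condition at `1`, for a function `u` with
`(u')^ν = v`: the increment `∫ v dν` of `u'` (Neumann), or the value `u 1` (Dirichlet). -/
noncomputable def BC.endValue (ν : Measure ℝ) : BC → (ℝ → ℝ) → (ℝ → ℝ) → ℝ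
  | .neumann, _, v => ∫ y, v y ∂ν
  | .dirichlet, u, _ => u 1

/-- `u` is a `C¹` representative of a solution of `(c - Δ_ν^b) u = g`. -/
structure SolvesResolventEq (ν : Measure ℝ) (b : BC) (c : ℝ) (g u : ℝ → ℝ) : Prop where
  hasMuLaplacian : HasMuLaplacian ν u fun y => c * u y - g y
  holds : b.Holds u

section BoundaryValueProblem

variable {b : BC} {ν : Measure ℝ} {c : ℝ} {u u' v v' g w φ : ℝ → ℝ}

theorem BC.continuous_profile (b : BC) : Continuous b.profile := by
  cases b
  exacts [continuous_const, continuous_id]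

theorem BC.profile_nonneg (b : BC) {x : ℝ} (hx : 0 ≤ x) : 0 ≤ b.profile x := by
  cases b
  exacts [zero_le_one, hx]

theorem BC.endValue_congr (b : BC) (hu : u 1 = u' 1) (hv : v =ᵐ[ν] v') :
    b.endValue ν u v = b.endValue ν u' v' := by
  cases b
  exacts [integral_congr_ae hv, hu]

theorem BC.endValue_add_mul (b : BC) (hv : Integrable v ν) (hv' : Integrable v' ν) (s : ℝ) :
    b.endValue ν (fun x => u x + s * u' x) (fun x => v x + s * v' x) =
      b.endValue ν u v + s * b.endValue ν u' v' := by
  cases b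
  · simp only [BC.endValue]
    rw [integral_add hv (hv'.const_mul s), integral_const_mul]
  · rfl

variable [Admissible ν]

theorem hasMuLaplacian_and_holds_iff (hv : Integrable v ν) :
    HasMuLaplacian ν u v ∧ b.Holds u ↔
      (∃ s, EqOn u (fun x => s * b.profile x + volterra ν v x) (Icc 0 1)) ∧
        b.endValue ν u v = 0 := by
  have h0 : (0 : ℝ) ∈ Icc (0 : ℝ) 1 := left_mem_Icc.2 zero_le_one
  have h1 : (1 : ℝ) ∈ Icc (0 : ℝ) 1 := right_mem_Icc.2 zero_le_one
  have hint : ∫ y in (0 : ℝ)..1, v y ∂ν = ∫ y, v y ∂ν := by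
    rw [intervalIntegral.integral_of_le zero_le_one, ← integral_Icc_eq_integral_Ioc, restrict_Icc]
  cases b with
  | neumann =>
    constructor
    · rintro ⟨hu, hd0, hd1⟩
      refine ⟨⟨u 0, fun x hx => ?_⟩, ?_⟩
      · simpa [hd0, BC.profile] using hu.eqOn hv hx
      · have := hu.2 1 h1
        rwa [hd0, hd1, zero_add, hint, eq_comm] at this
    · rintro ⟨⟨s, hs⟩, hend⟩
      have hs' : EqOn u (fun x => s + 0 * x + volterra ν v x) (Icc 0 1) := fun x hx => by
        simp [hs hx, BC.profile]
      refine ⟨hasMuLaplacian_of_eqOn hv hs', ?_, ?_⟩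
      · simp [derivWithin_of_eqOn_add_volterra hv hs' h0]
      · rw [derivWithin_of_eqOn_add_volterra hv hs' h1, hint, zero_add]
        exact hend
  | dirichlet =>
    constructor
    · rintro ⟨hu, hu0, hu1⟩
      refine ⟨⟨derivWithin u (Icc 0 1) 0, fun x hx => ?_⟩, hu1⟩
      simpa [hu0, BC.profile] using hu.eqOn hv hx
    · rintro ⟨⟨s, hs⟩, hend⟩
      have hs' : EqOn u (fun x => 0 + s * x + volterra ν v x) (Icc 0 1) := fun x hx => by
        simp [hs hx, BC.profile]
      exact ⟨hasMuLaplacian_of_eqOn hv hs', by simp [hs' h0, volterra_zero_right], hend⟩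

theorem solvesResolventEq_iff (hg : Integrable g ν) :
    SolvesResolventEq ν b c g u ↔
      (∃ s, IsVolterraSol ν c (fun x => s * b.profile x - volterra ν g x) u) ∧
        b.endValue ν u (fun y => c * u y - g y) = 0 := by
  by_cases hu : ContinuousOn u (Icc 0 1)
  · have hui : Integrable (fun y => c * u y) ν := (integrable_of_continuousOn hu).const_mul c
    have hV (x : ℝ) :
        volterra ν (fun y => c * u y - g y) x = c * volterra ν u x - volterra ν g x := by
      rw [volterra_sub hui hg, volterra_const_mul]
    have hsol (s : ℝ) : IsVolterraSol ν c (fun x => s * b.profile x - volterra ν g x) u ↔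
        EqOn u (fun x => s * b.profile x + volterra ν (fun y => c * u y - g y) x) (Icc 0 1) := by
      simp only [hV, ← add_sub_assoc, ← sub_add_eq_add_sub]
      exact ⟨fun h => h.eq, fun h => ⟨hu, h⟩⟩
    simp only [hsol]
    refine Iff.trans ?_ (hasMuLaplacian_and_holds_iff (hui.sub hg))
    exact ⟨fun h => ⟨h.1, h.2⟩, fun h => ⟨h.1, h.2⟩⟩
  · exact ⟨fun h => absurd h.hasMuLaplacian.1.continuousOn hu,
      fun ⟨⟨_, h⟩, _⟩ => absurd h.continuousOn hu⟩

theorem BC.endValue_pos (hc : 0 < c) (hφ : IsVolterraSol ν c b.profile φ) :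
    0 < b.endValue ν φ fun y => c * φ y := by
  have hle {x : ℝ} (hx : x ∈ Icc (0 : ℝ) 1) : b.profile x ≤ φ x :=
    hφ.le hc.le (fun y hy => b.profile_nonneg hy.1) hx
  cases b with
  | neumann =>
    have h1 : ∫ _, c ∂ν ≤ ∫ y, c * φ y ∂ν := by
      refine integral_mono_ae (integrable_const c) (hφ.integrable.const_mul c) ?_
      filter_upwards [ae_mem_Icc (ν := ν)] with y hy
      exact le_mul_of_one_le_right hc.le (hle hy)
    rw [integral_const, probReal_univ, one_smul] at h1
    exact hc.trans_le h1
  | dirichlet => exact zero_lt_one.trans_le (hle (right_mem_Icc.2 zero_le_one))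

/-- The value (Neumann) or slope (Dirichlet) at `0` of the solution `w + s φ` of the initial value
problem that meets the boundary condition at `1`; here `w` and `φ` solve the Volterra equations with
right-hand sides `-V_ν g` and `b.profile`. -/
noncomputable def shootingParam (ν : Measure ℝ) (b : BC) (c : ℝ) (g w φ : ℝ → ℝ) : ℝ :=
  -b.endValue ν w (fun y => c * w y - g y) / b.endValue ν φ fun y => c * φ y

theorem solvesResolventEq_iff_eqOn (hc : 0 < c) (hg : Integrable g ν)
    (hw : IsVolterraSol ν c (fun x => -volterra ν g x) w)
    (hφ : IsVolterraSol ν c b.profile φ) :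
    SolvesResolventEq ν b c g u ↔
      EqOn u (fun x => w x + shootingParam ν b c g w φ * φ x) (Icc 0 1) := by
  have hsol (s : ℝ) : IsVolterraSol ν c (fun x => s * b.profile x - volterra ν g x)
      fun x => w x + s * φ x := by
    simpa only [neg_add_eq_sub] using hw.add_const_mul hφ s
  have hwi : Integrable (fun y => c * w y - g y) ν := (hw.integrable.const_mul c).sub hg
  have hend {s : ℝ} (hus : EqOn u (fun x => w x + s * φ x) (Icc 0 1)) :
      b.endValue ν u (fun y => c * u y - g y) = 0 ↔ s = shootingParam ν b c g w φ := by
    have hv : (fun y => c * u y - g y) =ᵐ[ν] fun y => (c * w y - g y) + s * (c * φ y) := by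
      filter_upwards [ae_mem_Icc (ν := ν)] with y hy
      rw [hus hy]
      ring
    rw [b.endValue_congr (u' := fun x => w x + s * φ x) (hus (right_mem_Icc.2 zero_le_one)) hv,
      b.endValue_add_mul hwi (hφ.integrable.const_mul c), shootingParam,
      eq_div_iff (BC.endValue_pos hc hφ).ne', eq_neg_iff_add_eq_zero, add_comm]
  rw [solvesResolventEq_iff hg]
  constructor
  · rintro ⟨⟨s, hs⟩, hu⟩
    have hus := hs.eqOn (hsol s)
    rwa [(hend hus).1 hu] at hus
  · exact fun hus => ⟨⟨_, (hsol _).congr hus⟩, (hend hus).2 rfl⟩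

theorem exists_solvesResolventEq (b : BC) (hc : 0 < c) (hg : Integrable g ν) :
    ∃ u, SolvesResolventEq ν b c g u := by
  obtain ⟨w, hw⟩ := exists_isVolterraSol ν c (continuous_volterra hg).neg.continuousOn
  obtain ⟨φ, hφ⟩ := exists_isVolterraSol ν c b.continuous_profile.continuousOn
  exact ⟨_, (solvesResolventEq_iff_eqOn hc hg hw hφ).2 (eqOn_refl _ _)⟩

theorem SolvesResolventEq.eqOn (hc : 0 < c) (hg : Integrable g ν)
    (hu : SolvesResolventEq ν b c g u) (hu' : SolvesResolventEq ν b c g u') :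
    EqOn u u' (Icc 0 1) := by
  obtain ⟨w, hw⟩ := exists_isVolterraSol ν c (continuous_volterra hg).neg.continuousOn
  obtain ⟨φ, hφ⟩ := exists_isVolterraSol ν c b.continuous_profile.continuousOn
  exact ((solvesResolventEq_iff_eqOn hc hg hw hφ).1 hu).trans
    ((solvesResolventEq_iff_eqOn hc hg hw hφ).1 hu').symm

end BoundaryValueProblem

theorem gapLinear_congr {K : Set ℝ} (hK : IsClosed K) {g g' : ℝ → ℝ} (hgg' : EqOn g g' K)
    {p q : ℝ} (hp : p ∈ K) (hq : q ∈ K) :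
    EqOn (gapLinear K g) (gapLinear K g') (Icc p q) := by
  intro x hx
  obtain ⟨l, hl, r, hr, hgap, hxlr, -, -⟩ := exists_gap hK hp hq hx
  rw [gapLinear_of_gap hl hr hgap hxlr, gapLinear_of_gap hl hr hgap hxlr, hgg' hl, hgg' hr]

theorem supNorm_nonneg {ν : Measure ℝ} {b : BC} (f : CSpace ν b) : 0 ≤ supNorm f :=
  Real.iSup_nonneg fun _ => abs_nonneg _

theorem HasMuLaplacian.congr_ae {ν : Measure ℝ} {u v w : ℝ → ℝ}
    (hu : HasMuLaplacian ν u v) (hvw : v =ᵐ[ν] w) : HasMuLaplacian ν u w := by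
  refine ⟨hu.1, fun x hx => ?_⟩
  rw [hu.2 x hx, intervalIntegral.integral_congr_ae (hvw.mono fun y hy _ => hy)]

section Resolvent

variable {ν : Measure ℝ} [Admissible ν] {b : BC} {c : ℝ} {g u v w : ℝ → ℝ}

theorem eqOn_support_of_ae_eq (hu : ContinuousOn u (Icc 0 1)) (hv : ContinuousOn v (Icc 0 1))
    (huv : u =ᵐ[ν] v) : EqOn u v ν.support := fun x hx => by
  refine sub_eq_zero.1 (eq_zero_on_support (μ := ν) (f := fun y => u y - v y) (hu.sub hv) ?_ hx)
  filter_upwards [huv] with y hy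
  simp [hy]

theorem rep_eqOn_gapLinear (f : CSpace ν b) (hu : ContinuousOn u (Icc 0 1)) (hfu : f.1 =ᵐ[ν] u) :
    EqOn (rep f) (gapLinear ν.support u) (Icc 0 1) := by
  have hf := f.2.choose_spec
  exact gapLinear_congr Measure.isClosed_support
    (eqOn_support_of_ae_eq hf.1 hu (hf.2.2.symm.trans hfu)) Admissible.zero_mem Admissible.one_mem

theorem supNorm_le (f : CSpace ν b) (hu : ContinuousOn u (Icc 0 1)) (hfu : f.1 =ᵐ[ν] u) {ε : ℝ}
    (hε : ∀ x ∈ Icc (0 : ℝ) 1, |u x| ≤ ε) : supNorm f ≤ ε := by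
  refine Real.iSup_le (fun x => ?_) ((abs_nonneg _).trans (hε 0 (left_mem_Icc.2 zero_le_one)))
  rw [rep_eqOn_gapLinear f hu hfu (support_subset x.2), gapLinear_of_mem x.2]
  exact hε x (support_subset x.2)

theorem embed_ae_eq {μ : Measure ℝ} [Admissible μ] (f : CSpace μ b) :
    (embed ν f).1 =ᵐ[ν] rep f :=
  MemLp.coeFn_toLp (memLp_of_continuousOn (continuousOn_rep f))

theorem exists_shifted_eq_iff {U G : Lp ℝ 2 ν} (hG : G =ᵐ[ν] g) :
    (∃ W : (laplacian ν b).domain, (W : Lp ℝ 2 ν) = U ∧ shifted ν b c W = G) ↔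
      ∃ u, SolvesResolventEq ν b c g u ∧ U =ᵐ[ν] u := by
  have hgraph : (∃ W : (laplacian ν b).domain, (W : Lp ℝ 2 ν) = U ∧ shifted ν b c W = G) ↔
      (U, c • U - G) ∈ laplacianGraph ν b := by
    rw [← laplacian_graph, LinearPMap.mem_graph_iff]
    refine exists_congr fun W => and_congr_right fun hW => ?_
    rw [shifted, hW, sub_eq_iff_eq_add, eq_sub_iff_add_eq', eq_comm]
  have hae {u : ℝ → ℝ} (hUu : U =ᵐ[ν] u) :
      (c • U - G : Lp ℝ 2 ν) =ᵐ[ν] fun y => c * u y - g y := by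
    filter_upwards [Lp.coeFn_sub (c • U) G, Lp.coeFn_smul c U, hUu, hG] with y h1 h2 h3 h4
    rw [h1, Pi.sub_apply, h2, Pi.smul_apply, h3, h4, smul_eq_mul]
  rw [hgraph]
  constructor
  · rintro ⟨u, hu, hb, hUu⟩
    exact ⟨u, ⟨hu.congr_ae (hae hUu), hb⟩, hUu⟩
  · rintro ⟨u, hu, hUu⟩
    exact ⟨u, hu.hasMuLaplacian.congr_ae (hae hUu).symm, hu.holds, hUu⟩

theorem shifted_injective (b : BC) (hc : 0 < c) : Function.Injective (shifted ν b c) := by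
  intro U W hUW
  have hG := ae_eq_refl (μ := ν) (shifted ν b c W)
  obtain ⟨u, hu, hUu⟩ := (exists_shifted_eq_iff hG).1 ⟨U, rfl, hUW⟩
  obtain ⟨w, hw, hWw⟩ := (exists_shifted_eq_iff hG).1 ⟨W, rfl, rfl⟩
  have huw : u =ᵐ[ν] w := ae_mem_Icc.mono (hu.eqOn hc (integrable_coe _) hw)
  exact Subtype.ext (Lp.ext (hUu.trans (huw.trans hWw.symm)))

theorem shifted_surjective (b : BC) (hc : 0 < c) : Function.Surjective (shifted ν b c) := by
  intro G
  obtain ⟨u, hu⟩ := exists_solvesResolventEq b hc (integrable_coe G)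
  obtain ⟨W, -, hW⟩ := (exists_shifted_eq_iff (ae_eq_refl G)).2
    ⟨u, hu, MemLp.coeFn_toLp (memLp_of_continuousOn hu.hasMuLaplacian.1.continuousOn)⟩
  exact ⟨W, hW⟩

theorem shifted_bijective (b : BC) (hc : 0 < c) : Function.Bijective (shifted ν b c) :=
  ⟨shifted_injective b hc, shifted_surjective b hc⟩

theorem SolvesResolventEq.congr (hu : SolvesResolventEq ν b c g u) (hvu : EqOn v u (Icc 0 1)) :
    SolvesResolventEq ν b c g v := by
  have h0 : (0 : ℝ) ∈ Icc (0 : ℝ) 1 := left_mem_Icc.2 zero_le_one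
  have h1 : (1 : ℝ) ∈ Icc (0 : ℝ) 1 := right_mem_Icc.2 zero_le_one
  have hd {x : ℝ} (hx : x ∈ Icc (0 : ℝ) 1) :
      derivWithin v (Icc 0 1) x = derivWithin u (Icc 0 1) x := derivWithin_congr hvu (hvu hx)
  have hv : HasMuLaplacian ν v fun y => c * u y - g y :=
    ⟨hu.hasMuLaplacian.1.congr hvu, fun x hx => by rw [hd hx, hd h0, hu.hasMuLaplacian.2 x hx]⟩
  refine ⟨hv.congr_ae (ae_mem_Icc.mono fun y hy => by simp only [hvu hy]), ?_⟩
  cases b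
  exacts [⟨(hd h0).trans hu.holds.1, (hd h1).trans hu.holds.2⟩,
    ⟨(hvu h0).trans hu.holds.1, (hvu h1).trans hu.holds.2⟩]

theorem solvesResolventEq_rep_resolventC (hc : 0 < c) (f : CSpace ν b)
    (hg : ContinuousOn g (Icc 0 1)) (hfg : f.1 =ᵐ[ν] g) :
    SolvesResolventEq ν b c g (rep (resolventC ν b c f)) := by
  have hgi := integrable_of_continuousOn (ν := ν) hg
  have hR : shifted ν b c (resolvent ν b c f) = f.1 :=
    Function.rightInverse_invFun (shifted_surjective b hc) f.1
  obtain ⟨u, hu, hRu⟩ := (exists_shifted_eq_iff hfg).1 ⟨_, rfl, hR⟩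
  have huc := hu.hasMuLaplacian.1.continuousOn
  refine hu.congr ((rep_eqOn_gapLinear (resolventC ν b c f) huc hRu).trans ?_)
  exact hu.hasMuLaplacian.eqOn_gapLinear
    (((integrable_of_continuousOn huc).const_mul c).sub hgi)

end Resolvent

theorem tendstoUniformlyOn_refl {ι α β : Type*} [UniformSpace β] (f : α → β) (l : Filter ι)
    (s : Set α) : TendstoUniformlyOn (fun _ => f) f l s :=
  fun _ hU => .of_forall fun _ _ _ => refl_mem_uniformity hU

section WeakConvergence

variable {ι : Type*} {l : Filter ι} {μ : Measure ℝ} [Admissible μ] {μn : ι → Measure ℝ}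
  [∀ n, Admissible (μn n)] {b : BC} {c : ℝ} {G h u w g φ : ℝ → ℝ} {Gn hn un wn φn : ι → ℝ → ℝ}

theorem tendsto_integral_of_continuousOn
    (hweak : Tendsto (fun n => toProb (μn n)) l (𝓝 (toProb μ)))
    (hG : ContinuousOn G (Icc 0 1)) :
    Tendsto (fun n => ∫ y, G y ∂(μn n)) l (𝓝 (∫ y, G y ∂μ)) := by
  let ψ : BoundedContinuousFunction ℝ ℝ :=
    (BoundedContinuousFunction.mkOfCompact
      ⟨(Icc (0 : ℝ) 1).domRestrict G, continuousOn_iff_continuous_domRestrict.1 hG⟩).compContinuous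
      ⟨projIcc 0 1 zero_le_one, continuous_projIcc⟩
  have hψ (ν : Measure ℝ) [Admissible ν] : ∫ y, G y ∂ν = ∫ y, ψ y ∂ν := by
    refine integral_congr_ae ?_
    filter_upwards [ae_mem_Icc (ν := ν)] with y hy
    simp [ψ, projIcc_of_mem _ hy]
  simp only [hψ]
  exact ProbabilityMeasure.tendsto_iff_forall_integral_tendsto.1 hweak ψ

theorem tendsto_integral_of_tendstoUniformlyOn
    (hweak : Tendsto (fun n => toProb (μn n)) l (𝓝 (toProb μ)))
    (hGn : ∀ n, ContinuousOn (Gn n) (Icc 0 1)) (hG : ContinuousOn G (Icc 0 1))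
    (hlim : TendstoUniformlyOn Gn G l (Icc 0 1)) :
    Tendsto (fun n => ∫ y, Gn n y ∂(μn n)) l (𝓝 (∫ y, G y ∂μ)) := by
  have hdiff : Tendsto (fun n => ∫ y, (Gn n y - G y) ∂(μn n)) l (𝓝 0) := by
    refine Metric.tendsto_nhds.2 fun ε hε => ?_
    filter_upwards [Metric.tendstoUniformlyOn_iff.1 hlim (ε / 2) (half_pos hε)] with n hn
    rw [dist_zero_right]
    refine (norm_integral_le_of_norm_le_const (C := ε / 2) ?_).trans_lt ?_
    · filter_upwards [ae_mem_Icc (ν := μn n)] with y hy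
      rw [← dist_eq_norm, dist_comm]
      exact (hn y hy).le
    · simpa using hε
  have hsum := (tendsto_integral_of_continuousOn hweak hG).add hdiff
  rw [add_zero] at hsum
  refine hsum.congr fun n => ?_
  rw [integral_sub (integrable_of_continuousOn (hGn n)) (integrable_of_continuousOn hG),
    add_sub_cancel]

theorem tendstoUniformlyOn_volterra
    (hweak : Tendsto (fun n => toProb (μn n)) l (𝓝 (toProb μ)))
    (hG : ContinuousOn G (Icc 0 1)) :
    TendstoUniformlyOn (fun n => volterra (μn n) G) (volterra μ G) l (Icc 0 1) := by
  obtain ⟨B, hB⟩ := isCompact_Icc.exists_bound_of_continuousOn hG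
  have hlip (n : ι) : LipschitzWith B.toNNReal fun x : Icc (0 : ℝ) 1 => volterra (μn n) G x :=
    fun x x' => lipschitzWith_volterra hG (fun y hy => (hB y hy).trans B.le_coe_toNNReal) x x'
  have hpointwise : Tendsto (fun n (x : Icc (0 : ℝ) 1) => volterra (μn n) G x) l
      (𝓝 fun x => volterra μ G x) :=
    tendsto_pi_nhds.2 fun x => tendsto_integral_of_continuousOn hweak (by fun_prop)
  rw [tendstoUniformlyOn_iff_tendstoUniformly_comp_coe]
  exact UniformFun.tendsto_iff_tendstoUniformly.1
    ((Equicontinuous.tendsto_uniformFun_iff_pi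
      (LipschitzWith.uniformEquicontinuous _ _ hlip).equicontinuous l _).2 hpointwise)

theorem IsVolterraSol.tendstoUniformlyOn
    (hweak : Tendsto (fun n => toProb (μn n)) l (𝓝 (toProb μ)))
    (hun : ∀ n, IsVolterraSol (μn n) c (hn n) (un n)) (hu : IsVolterraSol μ c h u)
    (hlim : TendstoUniformlyOn hn h l (Icc 0 1)) : TendstoUniformlyOn un u l (Icc 0 1) := by
  set rn : ι → ℝ → ℝ := fun n x => hn n x - (u x - c * volterra (μn n) u x)
  have hrn : TendstoUniformlyOn rn 0 l (Icc 0 1) := by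
    have hV := (Real.uniformContinuous_const_mul (x := c)).comp_tendstoUniformlyOn
      (tendstoUniformlyOn_volterra hweak hu.continuousOn)
    refine (hlim.fun_sub ((tendstoUniformlyOn_refl u l _).fun_sub hV)).congr_right fun x hx => ?_
    simp [hu.eq x hx]
  have hdiff (n : ι) : IsVolterraSol (μn n) c (rn n) fun x => un n x - u x :=
    (hun n).sub ⟨hu.continuousOn, fun x _ => (sub_add_cancel _ _).symm⟩
  refine Metric.tendstoUniformlyOn_iff.2 fun ε hε => ?_
  obtain ⟨δ, hδ, hδε⟩ : ∃ δ > 0, 2 * δ * Real.exp (2 * |c|) < ε :=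
    ⟨ε / (4 * Real.exp (2 * |c|)), by positivity, by field_simp; norm_num⟩
  filter_upwards [Metric.tendstoUniformlyOn_iff.1 hrn δ hδ] with n hn x hx
  rw [dist_comm, Real.dist_eq]
  exact ((hdiff n).abs_le (fun y hy => by simpa using (hn y hy).le) hx).trans_lt hδε

theorem BC.tendsto_endValue (b : BC)
    (hweak : Tendsto (fun n => toProb (μn n)) l (𝓝 (toProb μ)))
    (hlim : TendstoUniformlyOn un u l (Icc 0 1)) (hGn : ∀ n, ContinuousOn (Gn n) (Icc 0 1))
    (hG : ContinuousOn G (Icc 0 1)) (hGlim : TendstoUniformlyOn Gn G l (Icc 0 1)) :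
    Tendsto (fun n => b.endValue (μn n) (un n) (Gn n)) l (𝓝 (b.endValue μ u G)) := by
  cases b
  exacts [tendsto_integral_of_tendstoUniformlyOn hweak hGn hG hGlim,
    hlim.tendsto_at (right_mem_Icc.2 zero_le_one)]

theorem tendsto_shootingParam
    (hweak : Tendsto (fun n => toProb (μn n)) l (𝓝 (toProb μ))) (hc : 0 < c)
    (hg : ContinuousOn g (Icc 0 1)) (hwn : ∀ n, ContinuousOn (wn n) (Icc 0 1))
    (hw : ContinuousOn w (Icc 0 1)) (hwlim : TendstoUniformlyOn wn w l (Icc 0 1))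
    (hφn : ∀ n, ContinuousOn (φn n) (Icc 0 1)) (hφ : IsVolterraSol μ c b.profile φ)
    (hφlim : TendstoUniformlyOn φn φ l (Icc 0 1)) :
    Tendsto (fun n => shootingParam (μn n) b c g (wn n) (φn n)) l
      (𝓝 (shootingParam μ b c g w φ)) := by
  have hmul {v : ℝ → ℝ} {vn : ι → ℝ → ℝ} (hv : TendstoUniformlyOn vn v l (Icc 0 1)) :
      TendstoUniformlyOn (fun n x => c * vn n x) (fun x => c * v x) l (Icc 0 1) :=
    Real.uniformContinuous_const_mul.comp_tendstoUniformlyOn hv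
  refine Tendsto.div (Tendsto.neg ?_) ?_ (BC.endValue_pos hc hφ).ne'
  · refine b.tendsto_endValue hweak hwlim (fun n => ((hwn n).const_mul c).sub hg)
      ((hw.const_mul c).sub hg) ?_
    exact (hmul hwlim).fun_sub (tendstoUniformlyOn_refl g l _)
  · exact b.tendsto_endValue hweak hφlim (fun n => (hφn n).const_mul c)
      (hφ.continuousOn.const_mul c) (hmul hφlim)

theorem SolvesResolventEq.tendstoUniformlyOn
    (hweak : Tendsto (fun n => toProb (μn n)) l (𝓝 (toProb μ))) (hc : 0 < c)
    (hg : ContinuousOn g (Icc 0 1)) (hun : ∀ n, SolvesResolventEq (μn n) b c g (un n))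
    (hu : SolvesResolventEq μ b c g u) : TendstoUniformlyOn un u l (Icc 0 1) := by
  have hV (ν : Measure ℝ) [Admissible ν] : ContinuousOn (fun x => -volterra ν g x) (Icc 0 1) :=
    (continuous_volterra (integrable_of_continuousOn hg)).neg.continuousOn
  have hprofile := b.continuous_profile.continuousOn (s := Icc 0 1)
  obtain ⟨w, hw⟩ := exists_isVolterraSol μ c (hV μ)
  obtain ⟨φ, hφ⟩ := exists_isVolterraSol μ c hprofile
  choose wn hwn using fun n => exists_isVolterraSol (μn n) c (hV (μn n))
  choose φn hφn using fun n => exists_isVolterraSol (μn n) c hprofile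
  have hwlim : TendstoUniformlyOn wn w l (Icc 0 1) :=
    IsVolterraSol.tendstoUniformlyOn hweak hwn hw (tendstoUniformlyOn_volterra hweak hg).fun_neg
  have hφlim : TendstoUniformlyOn φn φ l (Icc 0 1) :=
    IsVolterraSol.tendstoUniformlyOn hweak hφn hφ (tendstoUniformlyOn_refl _ l _)
  have hslim := tendsto_shootingParam hweak hc hg (fun n => (hwn n).continuousOn) hw.continuousOn
    hwlim (fun n => (hφn n).continuousOn) hφ hφlim
  have hsφlim : TendstoUniformlyOn
      (fun n x => shootingParam (μn n) b c g (wn n) (φn n) * φn n x)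
      (fun x => shootingParam μ b c g w φ * φ x) l (Icc 0 1) := by
    rw [← tendstoLocallyUniformlyOn_iff_tendstoUniformlyOn_of_compact isCompact_Icc] at hφlim ⊢
    exact (hslim.tendstoUniformlyOn_const _).tendstoLocallyUniformlyOn.fun_mul₀ hφlim
      continuousOn_const hφ.continuousOn
  have hgi {ν : Measure ℝ} [Admissible ν] : Integrable g ν := integrable_of_continuousOn hg
  exact ((hwlim.fun_add hsφlim).congr (.of_forall fun n =>
    ((solvesResolventEq_iff_eqOn hc hgi (hwn n) (hφn n)).1 (hun n)).symm)).congr_right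
    ((solvesResolventEq_iff_eqOn hc hgi hw hφ).1 hu).symm

theorem tendsto_supNorm_resolventC_sub
    (hweak : Tendsto (fun n => toProb (μn n)) l (𝓝 (toProb μ))) (hc : 0 < c)
    (f : CSpace μ b) :
    Tendsto (fun n => supNorm (resolventC (μn n) b c (embed (μn n) f) -
      embed (μn n) (resolventC μ b c f))) l (𝓝 0) := by
  set u := rep (resolventC μ b c f)
  set un : ι → ℝ → ℝ := fun n => rep (resolventC (μn n) b c (embed (μn n) f))
  have hlim : TendstoUniformlyOn un u l (Icc 0 1) :=
    SolvesResolventEq.tendstoUniformlyOn hweak hc (continuousOn_rep f)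
      (fun n => solvesResolventEq_rep_resolventC hc _ (continuousOn_rep f) (embed_ae_eq f))
      (solvesResolventEq_rep_resolventC hc f (continuousOn_rep f) (coe_ae_eq_rep f))
  have hae (n : ι) : (resolventC (μn n) b c (embed (μn n) f) -
      embed (μn n) (resolventC μ b c f)).1 =ᵐ[μn n] fun x => un n x - u x :=
    (Lp.coeFn_sub _ _).trans ((coe_ae_eq_rep _).sub (embed_ae_eq _))
  refine Metric.tendsto_nhds.2 fun ε hε => ?_
  filter_upwards [Metric.tendstoUniformlyOn_iff.1 hlim (ε / 2) (half_pos hε)] with n hn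
  rw [Real.dist_0_eq_abs, abs_of_nonneg (supNorm_nonneg _)]
  refine (supNorm_le _ ((continuousOn_rep _).fun_sub (continuousOn_rep _)) (hae n)
    fun x hx => ?_).trans_lt (half_lt_self hε)
  rw [← Real.dist_eq, dist_comm]
  exact (hn x hx).le

end WeakConvergence

end KreinFeller

theorem theorem5p4_general {ι : Type*} {l : Filter ι} (μ : Measure ℝ) [KreinFeller.Admissible μ]
    (μn : ι → Measure ℝ) [∀ n, KreinFeller.Admissible (μn n)]
    (hweak : Tendsto (fun n => KreinFeller.toProb (μn n)) l (𝓝 (KreinFeller.toProb μ)))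
    (b : KreinFeller.BC) (c : ℝ) (hc : 0 < c) :
    Function.Bijective (KreinFeller.shifted μ b c) ∧
    (∀ n, Function.Bijective (KreinFeller.shifted (μn n) b c)) ∧
    ∀ f : KreinFeller.CSpace μ b,
      Tendsto (fun n => KreinFeller.supNorm
        (KreinFeller.resolventC (μn n) b c (KreinFeller.embed (μn n) f) -
          KreinFeller.embed (μn n) (KreinFeller.resolventC μ b c f))) l (𝓝 0) :=
  ⟨KreinFeller.shifted_bijective b hc, fun _ => KreinFeller.shifted_bijective b hc,
    KreinFeller.tendsto_supNorm_resolventC_sub hweak hc⟩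

theorem theorem5p4 (μ : MeasureTheory.Measure ℝ) [KreinFeller.Admissible μ]
    (μn : ℕ → MeasureTheory.Measure ℝ) [∀ n, KreinFeller.Admissible (μn n)]
    (hweak : Filter.Tendsto (fun n => KreinFeller.toProb (μn n)) Filter.atTop
      (nhds (KreinFeller.toProb μ)))
    (hsupp : ∀ n, μ.support ⊆ (μn n).support)
    (b : KreinFeller.BC) (c : ℝ) (hc : 0 < c) :
    -- the resolvent operators are well defined
    Function.Bijective (KreinFeller.shifted μ b c) ∧
    (∀ n, Function.Bijective (KreinFeller.shifted (μn n) b c)) ∧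
    -- the convergence of the resolvents
    ∀ f : KreinFeller.CSpace μ b,
      Filter.Tendsto
        (fun n => KreinFeller.supNorm (KreinFeller.resolventC (μn n) b c (KreinFeller.embed (μn n) f) -
          KreinFeller.embed (μn n) (KreinFeller.resolventC μ b c f)))
        Filter.atTop (nhds 0) :=
  theorem5p4_general μ μn hweak b c hc
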